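/- **Setting.** Let $A$ be a (not necessarily unital) C*-algebra and let $\alpha$ be a $*$-automorphism of $A$. The *mapping torus* of $\alpha$ is the C*-algebra $$M_\alpha=\{f\in C([0,1],A) : f(1)=\alpha(f(0))\},$$ and for $t\in\mathbb R$ its time-$t$ automorphism $\phi_t$ is given, for $f\in M_\alpha$ and $s\in[0,1]$, by $(\phi_t f)(s)=\alpha^n(f(s+t-n))$, where $n$ is the integer with $n\le s+t<n+1$. For a Hilbert space $H$, let $CPA(A,H)$ be the collection of triples $(\varphi,\psi,B)$ where $B$ is a finite dimensional C*-algebra and $\varphi:A\to B$, $\psi:B\to\mathcal B(H)$ are contractive completely positive maps. A C*-algebra $A$ is *exact* (equivalently, nuclearly embeddable) if it has a faithful $*$-representation $\pi:A\to\mathcal B(H)$ such that for every finite $\omega\subset A$ and $\delta>0$ there is $(\varphi,\psi,B)\in CPA(A,H)$ with $\|\psi(\varphi(x))-\pi(x)\|<\delta$ for all $x\in\omega$. For a faithful $*$-representation $\pi:A\to\mathcal B(H)$, a finite set $\omega\subset A$ and $\delta>0$ put $$rcp(\omega,\delta)=\inf\{\operatorname{rank}(B) : (\varphi,\psi,B)\in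 CPA(A,H),\ \|\psi(\varphi(x))-\pi(x)\|<\delta\ \text{ for all } x\in\omega\}\in\mathbb N\cup\{\infty\},$$ where $\operatorname{rank}(B)$ is the dimension of a maximal abelian (self-adjoint) subalgebra of $B$ and $\inf\emptyset=\infty$. With $\log 0=-\infty$ and $\log\infty=\infty$, put $$\mathrm{ht}(\alpha,\omega,\delta)=\limsup_{m\to\infty}\frac1m\log rcp\big(\omega\cup\alpha(\omega)\cup\dots\cup\alpha^{m-1}(\omega),\delta\big).$$ The *Voiculescu–Brown entropy* of $\alpha$ is $\mathrm{ht}(\alpha)=\sup_{\omega}\sup_{\delta>0}\mathrm{ht}(\alpha,\omega,\delta)\in[-\infty,\infty]$, the first supremum being over all finite subsets $\omega$ of $A$. **Proposition.** Let $A$ be an exact C*-algebra and let $\alpha$ be an automorphism of $A$. Then $M_\alpha$ is exact, and $$\mathrm{ht}(\phi_1)=\mathrm{ht}(\alpha),$$ where $\mathrm{ht}(\alpha)$ may be computed in any faithful $*$-representation of $A$ and $\mathrm{ht}(\phi_1)$ in any faithful $*$-representation of $M_\alpha$. -/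

import Mathlib

open scoped CStarAlgebra unitInterval

universe u v w

noncomputable section

/-! ### The mapping torus of an automorphism and its flow -/

section MappingTorus

variable {A : Type*} [NonUnitalCStarAlgebra A]

/-- The continuous functions `f : [0,1] → A` such that `f 1 = α (f 0)`, as a star subalgebra of
`C([0,1], A)`. -/
def mappingTorusSubalgebra (α : A ≃⋆ₐ[ℂ] A) : NonUnitalStarSubalgebra ℂ C(I, A) where
  carrier := {f | f 1 = α (f 0)}
  add_mem' {f g} hf hg := by
    simp only [Set.mem_ofPred_eq] at hf hg ⊢
    simp [hf, hg]
  zero_mem' := by simp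
  mul_mem' {f g} hf hg := by
    simp only [Set.mem_ofPred_eq] at hf hg ⊢
    simp [hf, hg]
  smul_mem' c f hf := by
    simp only [Set.mem_ofPred_eq] at hf ⊢
    simp [hf]
  star_mem' {f} hf := by
    simp only [Set.mem_ofPred_eq] at hf ⊢
    simp [hf, map_star]

lemma mem_mappingTorusSubalgebra (α : A ≃⋆ₐ[ℂ] A) (f : C(I, A)) :
    f ∈ mappingTorusSubalgebra α ↔ f 1 = α (f 0) := Iff.rfl

lemma starAut_continuous (α : A ≃⋆ₐ[ℂ] A) : Continuous α :=
  (StarAlgEquiv.isometry α).continuous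

instance mappingTorusSubalgebra_isClosed (α : A ≃⋆ₐ[ℂ] A) :
    IsClosed (mappingTorusSubalgebra α : Set C(I, A)) :=
  isClosed_eq (continuous_eval_const (1 : I))
    ((starAut_continuous α).comp (continuous_eval_const (0 : I)))

/-- The mapping torus `M_α = {f ∈ C([0,1], A) | f 1 = α (f 0)}`. -/
def MappingTorus (α : A ≃⋆ₐ[ℂ] A) : Type _ := mappingTorusSubalgebra α

/-- The mapping torus is a C⋆-algebra, with the operations and the norm of `C([0,1], A)`. -/
instance MappingTorus.instNonUnitalCStarAlgebra (α : A ≃⋆ₐ[ℂ] A) :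
    NonUnitalCStarAlgebra (MappingTorus α) :=
  inferInstanceAs (NonUnitalCStarAlgebra (mappingTorusSubalgebra α))

/-- The mapping torus carries the usual order of a C⋆-algebra: `x ≤ y` iff `y - x` is
self-adjoint with nonnegative spectrum. -/
instance MappingTorus.instPartialOrder (α : A ≃⋆ₐ[ℂ] A) : PartialOrder (MappingTorus α) :=
  CStarAlgebra.spectralOrder _

instance MappingTorus.instStarOrderedRing (α : A ≃⋆ₐ[ℂ] A) : StarOrderedRing (MappingTorus α) :=
  CStarAlgebra.spectralOrderedRing _

lemma fract_mem_unitInterval (x : ℝ) : x - (⌊x⌋ : ℤ) ∈ I :=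
  ⟨Int.fract_nonneg x, (Int.fract_lt_one x).le⟩

/-- The extension of `f ∈ M_α` to the line: `x ↦ α^n (f (x - n))`, where `n ≤ x < n + 1`. -/
def mappingTorusExtend (α : A ≃⋆ₐ[ℂ] A) (f : C(I, A)) (x : ℝ) : A :=
  (α ^ ⌊x⌋) (f ⟨x - (⌊x⌋ : ℤ), fract_mem_unitInterval x⟩)

lemma mappingTorusExtend_of_mem (α : A ≃⋆ₐ[ℂ] A) {f : C(I, A)}
    (hf : f ∈ mappingTorusSubalgebra α) (n : ℤ) {x : ℝ} (hx : x - (n : ℝ) ∈ I) :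
    mappingTorusExtend α f x = (α ^ n) (f ⟨x - (n : ℝ), hx⟩) := by
  rcases hx.2.lt_or_eq with h | h
  · obtain rfl : ⌊x⌋ = n := Int.floor_eq_iff.2 ⟨by linarith [hx.1], by linarith⟩
    rfl
  · have hn : ⌊x⌋ = n + 1 :=
      Int.floor_eq_iff.2 ⟨by push_cast; linarith, by push_cast; linarith⟩
    have h1 : (⟨x - (n : ℝ), hx⟩ : I) = 1 := Subtype.ext h
    have h0 : (⟨x - (⌊x⌋ : ℤ), fract_mem_unitInterval x⟩ : I) = 0 :=
      Subtype.ext <| by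
        have hn' : (⌊x⌋ : ℝ) = n + 1 := by exact_mod_cast hn
        change x - (⌊x⌋ : ℝ) = 0
        linarith
    rw [mappingTorusExtend, h1, h0, (mem_mappingTorusSubalgebra α f).1 hf, hn, zpow_add_one]
    rfl

lemma mappingTorusExtend_continuous (α : A ≃⋆ₐ[ℂ] A) {f : C(I, A)}
    (hf : f ∈ mappingTorusSubalgebra α) : Continuous (mappingTorusExtend α f) := by
  have hlf : LocallyFinite fun n : ℤ => Set.Icc (n : ℝ) (n + 1) := by
    intro x
    refine ⟨Set.Ioo (x - 1) (x + 1), Ioo_mem_nhds (by linarith) (by linarith),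
      (Set.finite_Icc (⌊x⌋ - 2) (⌊x⌋ + 2)).subset ?_⟩
    rintro n ⟨y, hy1, hy2⟩
    have h1 := Int.floor_le x
    have h2 := Int.lt_floor_add_one x
    simp only [Set.mem_Icc, Set.mem_Ioo] at hy1 hy2 ⊢
    have a1 : ((⌊x⌋ - 2 : ℤ) : ℝ) ≤ (n : ℝ) := by push_cast; linarith
    have a2 : (n : ℝ) ≤ ((⌊x⌋ + 2 : ℤ) : ℝ) := by push_cast; linarith
    exact ⟨by exact_mod_cast a1, by exact_mod_cast a2⟩
  refine hlf.continuous ?_ (fun n => isClosed_Icc) fun n => ?_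
  · refine Set.eq_univ_of_forall fun x => Set.mem_iUnion.2 ⟨⌊x⌋, Int.floor_le x, ?_⟩
    exact (Int.lt_floor_add_one x).le
  · have hc : Continuous fun x : ℝ =>
        (α ^ n) (f (Set.projIcc (0 : ℝ) 1 zero_le_one (x - (n : ℝ)))) :=
      (starAut_continuous (α ^ n)).comp
        (f.continuous.comp (continuous_projIcc.comp (continuous_id.sub continuous_const)))
    refine hc.continuousOn.congr fun x hx => ?_
    have hx' : x - (n : ℝ) ∈ I := ⟨by linarith [hx.1], by linarith [hx.2]⟩
    simp only [mappingTorusExtend_of_mem α hf n hx', Set.projIcc_of_mem zero_le_one hx']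

/-- Translation by `t`, as a map `M_α → M_α`: `(φ_t f)(s) = α^n (f (s + t - n))`, where `n` is the
integer with `n ≤ s + t < n + 1`. -/
def mappingTorusShift (α : A ≃⋆ₐ[ℂ] A) (t : ℝ) (f : mappingTorusSubalgebra α) :
    mappingTorusSubalgebra α :=
  ⟨⟨fun s : I => (α ^ ⌊(s : ℝ) + t⌋)
      ((f : C(I, A)) ⟨(s : ℝ) + t - (⌊(s : ℝ) + t⌋ : ℤ), fract_mem_unitInterval _⟩),
    (mappingTorusExtend_continuous α f.2).comp
      (continuous_subtype_val.add continuous_const)⟩, by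
    have h1 : ((1 : ℝ) + t) - ((⌊t⌋ + 1 : ℤ) : ℝ) ∈ I := by
      have := fract_mem_unitInterval t
      push_cast
      rwa [add_comm (1 : ℝ) t, add_sub_add_right_eq_sub]
    change mappingTorusExtend α f (1 + t) = α (mappingTorusExtend α f (0 + t))
    rw [zero_add, mappingTorusExtend_of_mem α f.2 (⌊t⌋ + 1) h1,
      mappingTorusExtend_of_mem α f.2 ⌊t⌋ (fract_mem_unitInterval t),
      show α ^ (⌊t⌋ + 1) = α * α ^ ⌊t⌋ by rw [add_comm, zpow_one_add]]
    change α ((α ^ ⌊t⌋) _) = α ((α ^ ⌊t⌋) _)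
    congr 4
    push_cast
    ring⟩

lemma mappingTorusShift_apply (α : A ≃⋆ₐ[ℂ] A) (t : ℝ) (f : mappingTorusSubalgebra α) (s : I) :
    (mappingTorusShift α t f : C(I, A)) s = mappingTorusExtend α f (s + t) := rfl

lemma mappingTorusExtend_shift (α : A ≃⋆ₐ[ℂ] A) (t : ℝ) (f : mappingTorusSubalgebra α) (x : ℝ) :
    mappingTorusExtend α (mappingTorusShift α t f : C(I, A)) x = mappingTorusExtend α f (x + t) := by
  have hy := fract_mem_unitInterval (x - (⌊x⌋ : ℤ) + t)
  have hx : x + t - ((⌊x⌋ + ⌊x - (⌊x⌋ : ℤ) + t⌋ : ℤ) : ℝ) ∈ I := by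
    convert hy using 1
    push_cast
    ring
  rw [mappingTorusExtend_of_mem α f.2 _ hx, mappingTorusExtend, mappingTorusShift_apply, zpow_add]
  change (α ^ ⌊x⌋) _ = (α ^ ⌊x⌋) ((α ^ _) _)
  rw [mappingTorusExtend]
  congr 4
  push_cast
  ring

lemma mappingTorusShift_shift_neg (α : A ≃⋆ₐ[ℂ] A) {t u : ℝ} (h : u + t = 0)
    (f : mappingTorusSubalgebra α) : mappingTorusShift α u (mappingTorusShift α t f) = f := by
  refine Subtype.ext (ContinuousMap.ext fun s => ?_)
  have hs : (s : ℝ) - ((0 : ℤ) : ℝ) ∈ I := by simp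
  rw [mappingTorusShift_apply, mappingTorusExtend_shift, add_assoc, h, add_zero,
    mappingTorusExtend_of_mem α f.2 0 hs]
  simp

/-- The time-`t` automorphism `φ_t` of the mapping torus. -/
def mappingTorusFlow (α : A ≃⋆ₐ[ℂ] A) (t : ℝ) : MappingTorus α ≃⋆ₐ[ℂ] MappingTorus α where
  toFun := mappingTorusShift α t
  invFun := mappingTorusShift α (-t)
  left_inv := mappingTorusShift_shift_neg α (neg_add_cancel t)
  right_inv := mappingTorusShift_shift_neg α (add_neg_cancel t)
  map_mul' _ _ := Subtype.ext (ContinuousMap.ext fun s => map_mul (α ^ ⌊(s : ℝ) + t⌋) _ _)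
  map_add' _ _ := Subtype.ext (ContinuousMap.ext fun s => map_add (α ^ ⌊(s : ℝ) + t⌋) _ _)
  map_star' _ := Subtype.ext (ContinuousMap.ext fun s => map_star (α ^ ⌊(s : ℝ) + t⌋) _)
  map_smul' c _ := Subtype.ext (ContinuousMap.ext fun s => map_smul (α ^ ⌊(s : ℝ) + t⌋) c _)

end MappingTorus

/-! ### Completely positive approximation and the Voiculescu–Brown entropy -/

/-- The rank of a finite dimensional C⋆-algebra `B`: the dimension of a maximal abelian
(self-adjoint) subalgebra of `B`. All of them have the same dimension, so that the infimum below
is that common value. -/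
def finDimRank (B : Type*) [CStarAlgebra B] : ℕ :=
  sInf {d | ∃ D : StarSubalgebra ℂ B,
    Maximal (fun S : StarSubalgebra ℂ B => ∀ x ∈ S, ∀ y ∈ S, x * y = y * x) D ∧
      d = Module.finrank ℂ D}

section Entropy

variable {A : Type u} [NonUnitalCStarAlgebra A] [PartialOrder A] [StarOrderedRing A]
  {H : Type v} [NormedAddCommGroup H] [InnerProductSpace ℂ H] [CompleteSpace H]

/-- `CPA(π, A)`: the triples `(φ, ψ, B)` with `B` a finite dimensional C⋆-algebra and
`φ : A → B`, `ψ : B → B(H)` contractive completely positive maps. Every finite dimensional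
C⋆-algebra is unital, and is isomorphic to one whose underlying type is in `Type`. -/
structure CPApprox (A : Type u) [NonUnitalCStarAlgebra A] [PartialOrder A] [StarOrderedRing A]
    (H : Type v) [NormedAddCommGroup H] [InnerProductSpace ℂ H] [CompleteSpace H] where
  /-- the finite dimensional C⋆-algebra -/
  B : Type
  [cstarAlgebra : CStarAlgebra B]
  [partialOrder : PartialOrder B]
  [starOrderedRing : StarOrderedRing B]
  [finiteDimensional : FiniteDimensional ℂ B]
  /-- the map into the finite dimensional algebra -/
  φ : A →CP B
  /-- the map into the operators on `H` -/
  ψ : B →CP (H →L[ℂ] H)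
  norm_φ_le : ∀ a, ‖φ a‖ ≤ ‖a‖
  norm_ψ_le : ∀ b, ‖ψ b‖ ≤ ‖b‖

/-- The rank of the finite dimensional algebra in a triple `(φ, ψ, B)`. -/
def CPApprox.rank (P : CPApprox A H) : ℕ :=
  letI := P.cstarAlgebra
  finDimRank P.B

/-- The operator `ψ (φ a)`. -/
def CPApprox.comp (P : CPApprox A H) (a : A) : H →L[ℂ] H :=
  letI := P.cstarAlgebra
  letI := P.partialOrder
  haveI := P.starOrderedRing
  P.ψ (P.φ a)

/-- `(φ, ψ, B)` approximates `π` on `ω` up to `δ`: `‖ψ (φ x) - π x‖ < δ` for all `x ∈ ω`. -/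
def CPApprox.Approximates (P : CPApprox A H) (π : A →⋆ₙₐ[ℂ] (H →L[ℂ] H)) (ω : Set A) (δ : ℝ) :
    Prop :=
  ∀ x ∈ ω, ‖P.comp x - π x‖ < δ

/-- `rcp(ω, δ)`, computed in the representation `π`; it is `⊤` if there is no approximation. -/
def rcp (π : A →⋆ₙₐ[ℂ] (H →L[ℂ] H)) (ω : Set A) (δ : ℝ) : ℕ∞ :=
  ⨅ P : {P : CPApprox A H // P.Approximates π ω δ}, (P.1.rank : ℕ∞)

/-- `ht(α, ω, δ) = limsup_m (1/m) log rcp(ω ∪ α(ω) ∪ ⋯ ∪ α^(m-1)(ω), δ)`, computed in the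
representation `π`. -/
def htAt (π : A →⋆ₙₐ[ℂ] (H →L[ℂ] H)) (α : A ≃⋆ₐ[ℂ] A) (ω : Set A) (δ : ℝ) : EReal :=
  Filter.limsup (fun m : ℕ =>
    (((1 / (m : ℝ) : ℝ)) : EReal) *
      ENNReal.log ((rcp π (⋃ j : Fin m, (⇑α)^[(j : ℕ)] '' ω) δ : ℕ∞) : ENNReal)) Filter.atTop

/-- The Voiculescu–Brown entropy `ht(α) = sup_ω sup_{δ > 0} ht(α, ω, δ)`, over the finite sets
`ω ⊆ A`, computed in the representation `π`. -/
def ht (π : A →⋆ₙₐ[ℂ] (H →L[ℂ] H)) (α : A ≃⋆ₐ[ℂ] A) : EReal :=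
  ⨆ ω : Finset A, ⨆ δ : {δ : ℝ // 0 < δ}, htAt π α (ω : Set A) δ

end Entropy

/-- Exactness of a C⋆-algebra, as nuclear embeddability: `A` has a faithful representation `π` on
a Hilbert space that is a nuclear map, that is, a point-norm limit of maps that factor through
finite dimensional C⋆-algebras by contractive completely positive maps. -/
def IsExactCStarAlgebra (A : Type u) [NonUnitalCStarAlgebra A] [PartialOrder A]
    [StarOrderedRing A] : Prop :=
  ∃ (H : Type u) (_ : NormedAddCommGroup H) (_ : InnerProductSpace ℂ H) (_ : CompleteSpace H)
    (π : A →⋆ₙₐ[ℂ] (H →L[ℂ] H)), Function.Injective π ∧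
      ∀ (ω : Finset A) (δ : ℝ), 0 < δ → ∃ P : CPApprox A H, P.Approximates π (ω : Set A) δ

end

/-!
The flow at time `1` is the automorphism `α` applied pointwise: `(φ₁ f)(s) = α (f s)`. So `φ₁` is a
continuous family of copies of `α`, and the two entropies are compared by moving completely positive
approximations between `A` and `M_α`.

The tool that makes this possible in arbitrary faithful representations is an extension theorem
(`exists_completelyPositive_extension`): if `i : C → D` is an injective homomorphism into a unital
C⋆-algebra and `θ` is a representation of `C` on `K`, there is a contractive completely positive map
`Θ : D → B(K)` with `Θ ∘ i = θ`. This is the case of Arveson's theorem in which the map to be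
extended is a homomorphism, and it needs only functionals: `θ` is decomposed into orthogonal cyclic
pieces, the vector functional of each cyclic vector is extended from `C` to a positive functional
on `D` by Hahn–Banach, and the direct sum of the GNS representations of these functionals,
compressed to `K`, is `Θ`. Composing the second leg of an approximation with `Θ` shows that `rcp`
does not depend on the faithful representation (`rcp_le_rcp_of_injective`).

* `ht α ≤ ht φ₁` (`ht_le_ht_mappingTorusFlow`): let `g : [0,1] → [0,1]` vanish at the end points,
  with `g (1/2) = 1`. Then `a ↦ g ⊗ a` is a contractive completely positive map `A → M_α` that
  intertwines `α` and `φ₁`, and evaluation at `1/2` is a left inverse of it. By the extension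
  theorem, an approximation of `{g ⊗ a | a ∈ ω}` becomes one of `ω` through an algebra of the same
  rank.
* `ht φ₁ ≤ ht α` (`ht_mappingTorusFlow_le_ht`): represent `M_α` on `ℓ²([0,1], H)` by the diagonal
  operators `diag (π (f s))`. A finite set of sections is determined up to `δ / 3` by its values
  at a finite set `t` of sample points, and the same `t` serves all of its iterates, because `α` is
  isometric. If `(φ, ψ, B)` approximates the sampled values, then
  `f ↦ (φ (f s))_{s ∈ t} ∈ B ^ t` followed by `b ↦ diag (ψ (b (q s)))`, where `q s` is the sample
  point assigned to `s`, approximates the sections. Diagonal operators with discontinuous entries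
  are harmless in `B(ℓ²([0,1], H))`, so that no partition of unity is needed. The rank is
  multiplied by at most `card t`, which does not change the exponential growth rate.

The second construction also proves that `M_α` is exact.
-/

noncomputable section

/-! ### Completely positive maps -/

section CompletelyPositive

lemma mul_self_mul_eq_zero_of_isSelfAdjoint {R : Type*} [NonUnitalCStarAlgebra R] {a : R}
    (ha : IsSelfAdjoint a) (h : a * a * a = 0) : a = 0 := by
  have h2 : star (a * a) * (a * a) = 0 := by
    rw [star_mul, ha.star_eq, ← mul_assoc, h, zero_mul]
  have h3 : star a * a = 0 := by
    rw [ha.star_eq]; exact CStarRing.star_mul_self_eq_zero_iff _ |>.1 h2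
  exact CStarRing.star_mul_self_eq_zero_iff _ |>.1 h3

/-- A variant of `CStarAlgebra.nonneg_iff_eq_star_mul_self` whose instance arguments can be found when
`R` is an algebra of matrices `CStarMatrix`; the scalar tower and functional calculus instances over
`ℝ` that the general version asks for are not found there. -/
lemma exists_eq_star_mul_self {R : Type*} [NonUnitalCStarAlgebra R] [PartialOrder R]
    [StarOrderedRing R] {a : R} (ha : 0 ≤ a) : ∃ x, a = star x * x :=
  CStarAlgebra.nonneg_iff_eq_star_mul_self.1 ha

/-- A self-adjoint element `T` is compressed by its negative part `P` to `-P ^ 3`, which vanishes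
only if `T` is nonnegative. -/
lemma exists_star_mul_mul_self_eq_neg {R : Type*} [NonUnitalCStarAlgebra R] [PartialOrder R]
    [StarOrderedRing R] {T : R} (hT : IsSelfAdjoint T) :
    ∃ P Q : R, star P * T * P = -(star Q * Q) ∧ (Q = 0 → 0 ≤ T) := by
  have hs : IsSelfAdjoint (T⁻) := (CFC.negPart_nonneg T).isSelfAdjoint
  have hX : star (T⁻) * T * T⁻ = -(T⁻ * T⁻ * T⁻) := by
    rw [hs.star_eq]
    nth_rw 2 [← CFC.posPart_sub_negPart T hT]
    rw [mul_sub, CFC.negPart_mul_posPart, zero_sub, neg_mul]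
  have h3 : 0 ≤ T⁻ * T⁻ * T⁻ := by
    have := star_left_conjugate_nonneg (CFC.negPart_nonneg T) (T⁻)
    rwa [hs.star_eq] at this
  obtain ⟨Q, hQ⟩ := exists_eq_star_mul_self h3
  refine ⟨T⁻, Q, by rw [hX, hQ], fun h => ?_⟩
  have : T⁻ = 0 := mul_self_mul_eq_zero_of_isSelfAdjoint hs (by rw [hQ, h]; simp)
  rw [← CFC.posPart_sub_negPart T hT, this, sub_zero]
  exact CFC.posPart_nonneg T

variable {n : Type*} [Fintype n] {E : Type*} [NonUnitalCStarAlgebra E]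

lemma CStarMatrix.star_mul_self_apply (R : CStarMatrix n n E) (i j : n) :
    (star R * R) i j = ∑ k, star (R k i) * R k j := by
  rw [CStarMatrix.mul_apply]; rfl

variable [PartialOrder E] [StarOrderedRing E]

lemma CStarMatrix.eq_zero_of_diag_star_mul_self_nonpos (R : CStarMatrix n n E)
    (h : ∀ i, (star R * R) i i ≤ 0) : R = 0 := by
  ext k i
  have h1 : ∑ k, star (R k i) * R k i ≤ 0 := by
    rw [← CStarMatrix.star_mul_self_apply]; exact h i
  have h2 := (Finset.sum_eq_zero_iff_of_nonneg (fun k _ => star_mul_self_nonneg (R k i))).1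
    (le_antisymm h1 (Finset.sum_nonneg fun k _ => star_mul_self_nonneg (R k i))) k
      (Finset.mem_univ k)
  exact CStarRing.star_mul_self_eq_zero_iff _ |>.1 h2

/-- A self-adjoint matrix is nonnegative if all its conjugates have nonnegative diagonal entries:
its conjugate by its own negative part is `-(Q⋆ Q)`, and `Q⋆ Q` has a diagonal of sums of squares.
This replaces the identification of the matrices over `B(K)` with the operators on a power
of `K`. -/
lemma CStarMatrix.nonneg_of_diag_conjugate_nonneg (T : CStarMatrix n n E) (hT : IsSelfAdjoint T)
    (h : ∀ (X : CStarMatrix n n E) (i : n), 0 ≤ (star X * T * X) i i) : 0 ≤ T := by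
  obtain ⟨P, Q, hPQ, h0⟩ := exists_star_mul_mul_self_eq_neg hT
  refine h0 (CStarMatrix.eq_zero_of_diag_star_mul_self_nonpos Q fun i => ?_)
  have := h P i
  rw [hPQ] at this
  simpa using this

variable {X Y Z : Type*} [NonUnitalCStarAlgebra X] [PartialOrder X] [StarOrderedRing X]
  [NonUnitalCStarAlgebra Y] [PartialOrder Y] [StarOrderedRing Y]
  [NonUnitalCStarAlgebra Z] [PartialOrder Z] [StarOrderedRing Z]

/-- The composition of two completely positive maps. -/
def CompletelyPositiveMap.comp (ψ : Y →CP Z) (φ : X →CP Y) : X →CP Z where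
  toLinearMap := ψ.toLinearMap ∘ₗ φ.toLinearMap
  map_cstarMatrix_nonneg' k M hM :=
    ψ.map_cstarMatrix_nonneg' k _ (φ.map_cstarMatrix_nonneg' k M hM)

/-- The completely positive map given by a linear map that sends matrices of the form `N⋆ N` to
matrices of the same form. -/
def CompletelyPositiveMap.ofStarMulSelf (f : X →ₗ[ℂ] Y)
    (h : ∀ (k : ℕ) (N : CStarMatrix (Fin k) (Fin k) X),
      ∃ R : CStarMatrix (Fin k) (Fin k) Y, (star N * N).map f = star R * R) : X →CP Y where
  toLinearMap := f
  map_cstarMatrix_nonneg' k M hM := by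
    obtain ⟨N, rfl⟩ := exists_eq_star_mul_self hM
    obtain ⟨R, hR⟩ := h k N
    rw [hR]
    exact star_mul_self_nonneg R

lemma CompletelyPositiveMap.exists_star_mul_self (f : X →CP Y) {k : ℕ}
    (N : CStarMatrix (Fin k) (Fin k) X) :
    ∃ R : CStarMatrix (Fin k) (Fin k) Y, (star N * N).map f = star R * R :=
  exists_eq_star_mul_self
    (f.map_cstarMatrix_nonneg' k _ (star_mul_self_nonneg N))

/-- A finite family of completely positive maps, as a completely positive map into the product. -/
def CompletelyPositiveMap.pi {ι : Type*} [Fintype ι] {Y : ι → Type*}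
    [∀ i, NonUnitalCStarAlgebra (Y i)] [∀ i, PartialOrder (Y i)] [∀ i, StarOrderedRing (Y i)]
    (f : ∀ i, X →CP Y i) : X →CP (∀ i, Y i) :=
  .ofStarMulSelf (LinearMap.pi fun i => (f i).toLinearMap) fun k N => by
    choose R hR using fun i => (f i).exists_star_mul_self N
    refine ⟨CStarMatrix.ofMatrix fun a b i => R i a b, ?_⟩
    refine CStarMatrix.ext fun a b => funext fun i => ?_
    have := congrFun (congrFun (hR i) a) b
    rw [CStarMatrix.star_mul_self_apply] at this ⊢
    rw [Finset.sum_apply]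
    exact this

section Compression

variable {H K : Type*} [NormedAddCommGroup H] [InnerProductSpace ℂ H] [CompleteSpace H]
  [NormedAddCommGroup K] [InnerProductSpace ℂ K] [CompleteSpace K]

open ContinuousLinearMap

/-- The compression `T ↦ V⋆ T V`, as a completely positive map. -/
def compressionCP (V : K →L[ℂ] H) : (H →L[ℂ] H) →CP (K →L[ℂ] K) where
  toFun T := adjoint V ∘L T ∘L V
  map_add' S T := by ext; simp
  map_smul' c T := by ext; simp
  map_cstarMatrix_nonneg' k M hM := by
    obtain ⟨N, rfl⟩ := exists_eq_star_mul_self hM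
    refine CStarMatrix.nonneg_of_diag_conjugate_nonneg _ ?_ fun Y i => ?_
    · refine CStarMatrix.ext fun i j => ?_
      rw [CStarMatrix.star_apply]
      have h : star ((star N * N) j i) = (star N * N) i j := by
        rw [← CStarMatrix.star_apply, (IsSelfAdjoint.star_mul_self N).star_eq]
      change adjoint (adjoint V ∘L ((star N * N) j i) ∘L V) = adjoint V ∘L ((star N * N) i j) ∘L V
      rw [adjoint_comp, adjoint_comp, adjoint_adjoint, ← star_eq_adjoint, h]
      rfl
    · have key : (star Y * (star N * N).map (fun T => adjoint V ∘L T ∘L V) * Y) i i =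
          ∑ m, adjoint (∑ l, N m l ∘L V ∘L Y l i) ∘L (∑ l, N m l ∘L V ∘L Y l i) := by
        have h : ∀ b a, (adjoint V ∘L ((star N * N) b a) ∘L V) =
            ∑ m, adjoint (N m b ∘L V) ∘L (N m a ∘L V) := fun b a => by
          ext x
          rw [CStarMatrix.star_mul_self_apply]
          simp [map_sum, star_eq_adjoint, adjoint_comp]
        simp only [CStarMatrix.mul_apply, CStarMatrix.map_apply, CStarMatrix.star_apply,
          star_eq_adjoint]
        ext x
        simp [map_sum, adjoint_comp]
        exact (Finset.sum_congr rfl fun a _ => Finset.sum_comm).trans Finset.sum_comm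
      erw [key]
      exact Finset.sum_nonneg fun m _ => by
        rw [nonneg_iff_isPositive]
        exact isPositive_adjoint_comp_self _

end Compression
end CompletelyPositive

/-! ### Direct sums of representations -/

section DirectSum

variable {ι : Type*} {H : ι → Type*} [∀ i, NormedAddCommGroup (H i)]
  [∀ i, InnerProductSpace ℂ (H i)]

/-- A diagonal operator is bounded by any common bound of its entries. -/
lemma norm_le_of_diagonal {T : lp H 2 →L[ℂ] lp H 2} (D : ∀ i, H i →L[ℂ] H i)
    (hT : ∀ x i, T x i = D i (x i)) {r : ℝ} (hr : 0 ≤ r) (hD : ∀ i, ‖D i‖ ≤ r) : ‖T‖ ≤ r := by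
  have : T = lp.mapCLM 2 D hr hD := by
    ext x i
    exact hT x i
  rw [this]
  exact lp.norm_mapCLM_le 2 D hr hD

variable [∀ i, CompleteSpace (H i)] {A : Type*} [NonUnitalCStarAlgebra A]

/-- The direct sum of a family of representations of a C⋆-algebra, on the Hilbert sum of the
underlying Hilbert spaces. -/
def directSumRep (π : ∀ i, A →⋆ₙₐ[ℂ] (H i →L[ℂ] H i)) :
    A →⋆ₙₐ[ℂ] (lp H 2 →L[ℂ] lp H 2) where
  toFun a := lp.mapCLM 2 (fun i => π i a) (norm_nonneg a)
    fun i => NonUnitalStarAlgHom.norm_apply_le (π i) a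
  map_zero' := by ext x i; simp
  map_add' a b := by ext x i; simp
  map_smul' c a := by ext x i; simp
  map_mul' a b := by ext x i; simp
  map_star' a := by
    rw [ContinuousLinearMap.star_eq_adjoint, ContinuousLinearMap.eq_adjoint_iff]
    intro x y
    simp [lp.inner_eq_tsum, map_star, ContinuousLinearMap.star_eq_adjoint,
      ContinuousLinearMap.adjoint_inner_left]

@[simp] lemma directSumRep_apply_apply (π : ∀ i, A →⋆ₙₐ[ℂ] (H i →L[ℂ] H i)) (a : A) (x : lp H 2)
    (i : ι) : directSumRep π a x i = π i a (x i) := rfl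

lemma directSumRep_single [DecidableEq ι] (π : ∀ i, A →⋆ₙₐ[ℂ] (H i →L[ℂ] H i)) (a : A) (i : ι)
    (x : H i) : directSumRep π a (lp.single 2 i x) = lp.single 2 i (π i a x) := by
  ext j
  rw [directSumRep_apply_apply, lp.single_apply, lp.single_apply]
  rcases eq_or_ne j i with rfl | h
  · simp
  · simp [h]

lemma directSumRep_injective (π : ∀ i, A →⋆ₙₐ[ℂ] (H i →L[ℂ] H i))
    (h : ∀ a, (∀ i, π i a = 0) → a = 0) : Function.Injective (directSumRep π) := by
  classical
  refine (injective_iff_map_eq_zero _).2 fun a ha => h a fun i => ?_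
  ext x
  have := congrArg (fun y : lp H 2 => y i)
    ((directSumRep_single π a i x).symm.trans (by rw [ha]))
  simpa using this

end DirectSum

/-! ### Partial isometries between Hilbert spaces -/

section Isometry

open ContinuousLinearMap
open scoped InnerProductSpace

variable {X K L : Type*} [AddCommGroup X] [Module ℂ X]
  [NormedAddCommGroup K] [InnerProductSpace ℂ K] [CompleteSpace K]
  [NormedAddCommGroup L] [InnerProductSpace ℂ L] [CompleteSpace L]

/-- Continuous linear maps agree if they do on the range of a linear map and on its orthogonal
complement. -/
lemma ContinuousLinearMap.eq_of_eq_on_range_of_eq_on_orthogonal {E : Type*} [NormedAddCommGroup E]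
    [NormedSpace ℂ E] (S : X →ₗ[ℂ] K) {f g : K →L[ℂ] E} (h : ∀ x, f (S x) = g (S x))
    (h' : ∀ y, (∀ x, ⟪S x, y⟫_ℂ = 0) → f y = g y) : f = g := by
  set M : Submodule ℂ K := S.range.topologicalClosure with hM
  have : CompleteSpace M := S.range.isClosed_topologicalClosure.completeSpace_coe
  have h1 : M ≤ (f - g).ker := S.range.topologicalClosure_minimal
    (by rintro _ ⟨x, rfl⟩; simp [h]) (f - g).isClosed_ker
  have h2 : Mᗮ ≤ (f - g).ker := fun y hy => by
    rw [hM, Submodule.orthogonal_closure] at hy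
    simp [h' y fun x => hy _ ⟨x, rfl⟩]
  have h3 := sup_le h1 h2
  rw [Submodule.sup_orthogonal_of_hasOrthogonalProjection] at h3
  ext y
  simpa [sub_eq_zero] using h3 (Submodule.mem_top (x := y))

/-- Two linear maps into Hilbert spaces that induce the same inner products on their domain are
intertwined by a partial isometry that vanishes on the orthogonal complement of the first range. -/
lemma exists_partialIsometry_of_inner_eq (S : X →ₗ[ℂ] K) (T : X →ₗ[ℂ] L)
    (h : ∀ x y, ⟪S x, S y⟫_ℂ = ⟪T x, T y⟫_ℂ) :
    ∃ V : K →L[ℂ] L, ‖V‖ ≤ 1 ∧ (∀ x, V (S x) = T x) ∧ (∀ x, adjoint V (T x) = S x) ∧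
      ∀ y, (∀ x, ⟪S x, y⟫_ℂ = 0) → V y = 0 := by
  set M : Submodule ℂ K := S.range.topologicalClosure with hM
  have : CompleteSpace M := S.range.isClosed_topologicalClosure.completeSpace_coe
  let e : X →ₗ[ℂ] M := S.codRestrict M fun x => S.range.le_topologicalClosure ⟨x, rfl⟩
  have hn : ∀ x, ‖T x‖ = ‖S x‖ := fun x => by
    rw [@norm_eq_sqrt_re_inner ℂ, @norm_eq_sqrt_re_inner ℂ, h]
  have hd : DenseRange e := by
    intro y
    have hy : (y : K) ∈ closure (Set.range S) := y.2
    rw [closure_subtype]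
    convert hy using 2
    ext z
    constructor
    · rintro ⟨_, ⟨x, rfl⟩, rfl⟩
      exact ⟨x, rfl⟩
    · rintro ⟨x, rfl⟩
      exact ⟨e x, ⟨x, rfl⟩, rfl⟩
  have hb : ∃ C, ∀ x, ‖T x‖ ≤ C * ‖e x‖ := ⟨1, fun x => by rw [one_mul, hn]; rfl⟩
  let V₀ : M →L[ℂ] L := T.extendOfNorm e
  have hV₀ : ∀ x, V₀ (e x) = T x := fun x => LinearMap.extendOfNorm_eq hd hb x
  have hV₀n : ‖V₀‖ ≤ 1 := LinearMap.opNorm_extendOfNorm_le hd zero_le_one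
    fun x => by rw [one_mul, hn]; rfl
  have horth : ∀ y, (∀ x, ⟪S x, y⟫_ℂ = 0) → y ∈ Mᗮ := fun y hy => by
    rw [hM, Submodule.orthogonal_closure]
    rintro _ ⟨x, rfl⟩
    exact hy x
  let V := V₀ ∘L M.orthogonalProjectionOnto
  have hVS : ∀ x, V (S x) = T x := fun x => by
    rw [← hV₀]
    exact congrArg V₀ (M.orthogonalProjectionOnto_mem_subspace_eq_self (e x))
  have hV0 : ∀ y, (∀ x, ⟪S x, y⟫_ℂ = 0) → V y = 0 := fun y hy => by
    change V₀ (M.orthogonalProjectionOnto y) = 0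
    rw [Submodule.orthogonalProjectionOnto_apply_of_mem_orthogonal (horth y hy),
      map_zero]
  refine ⟨V, ?_, hVS, fun x => ?_, hV0⟩
  · exact (opNorm_comp_le _ _).trans
      (mul_le_one₀ hV₀n (norm_nonneg _) M.orthogonalProjectionOnto_norm_le)
  · have key : innerSL ℂ (T x) ∘L V = innerSL ℂ (S x) :=
      eq_of_eq_on_range_of_eq_on_orthogonal S (fun z => by simp [hVS, h])
        fun y hy => by simp [hV0 y hy, hy x]
    refine ext_inner_right ℂ fun y => ?_
    rw [adjoint_inner_left]
    exact DFunLike.congr_fun key y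

end Isometry

/-! ### Extension of positive functionals -/

section StateExtension

open scoped ComplexOrder
open Filter Topology

variable {D : Type*} [CStarAlgebra D] [PartialOrder D] [StarOrderedRing D]

lemma norm_sub_half_smul_one_le {d : D} (hd : 0 ≤ d) {R : ℝ} (hR : ‖d‖ ≤ R) :
    ‖d - ((R / 2 : ℝ) : ℂ) • (1 : D)‖ ≤ R / 2 := by
  have hR0 : 0 ≤ R := (norm_nonneg d).trans hR
  rcases subsingleton_or_nontrivial D with hD | hD
  · rw [norm_of_subsingleton]; positivity
  have hsa : IsSelfAdjoint d := .of_nonneg hd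
  have h1 : d - ((R / 2 : ℝ) : ℂ) • (1 : D) = cfc (fun x : ℝ => x - R / 2) d := by
    rw [cfc_sub _ _ d, cfc_id' ℝ d, cfc_const _ d, Algebra.algebraMap_eq_smul_one,
      Complex.coe_smul]
  rw [h1]
  refine norm_cfc_le (by positivity) fun x hx => ?_
  have h2 : 0 ≤ x := spectrum_nonneg_of_nonneg hd hx
  have h3 : x ≤ R := by
    have := (spectrum.norm_le_norm_of_mem hx).trans hR
    rwa [Real.norm_of_nonneg h2] at this
  rw [Real.norm_eq_abs, abs_le]
  constructor <;> linarith

/-- A functional that attains its norm at `1` is positive: the spectrum of a nonnegative element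
`d` lies in every disc whose boundary contains `0` and `‖d‖`, so that `F d` lies in every disc
whose boundary contains `0` and `r * ‖d‖`, and these discs meet in a segment. -/
lemma map_nonneg_of_norm_le_map_one (F : D →ₗ[ℂ] ℂ) {r : ℝ} (hF : ∀ d, ‖F d‖ ≤ r * ‖d‖)
    (h1 : F 1 = r) {d : D} (hd : 0 ≤ d) : 0 ≤ F d := by
  rcases subsingleton_or_nontrivial D with hD | hD
  · rw [Subsingleton.elim d 0, map_zero]
  have hr : 0 ≤ r := by
    have := (norm_nonneg _).trans (hF 1)
    simpa using this
  set R := ‖d‖ with hR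
  set z := d - ((R / 2 : ℝ) : ℂ) • (1 : D) with hz
  have hzn : ‖z‖ ≤ R / 2 := norm_sub_half_smul_one_le hd le_rfl
  have hzs : IsSelfAdjoint z := by
    refine (IsSelfAdjoint.of_nonneg hd).sub ?_
    rw [Complex.coe_smul]
    exact IsSelfAdjoint.smul (IsSelfAdjoint.all (R / 2)) (IsSelfAdjoint.one D)
  -- `F d` lies in the disc with centre `r * (R / 2 - t * I)`, for every `t`
  have key : ∀ t : ℝ, ((F d).re - r * (R / 2)) ^ 2 + ((F d).im + r * t) ^ 2 ≤
      r ^ 2 * ((R / 2) ^ 2 + t ^ 2) := fun t => by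
    set x := z + ((t : ℂ) * Complex.I) • (1 : D) with hx
    have hxx : star x * x = z * z + ((t ^ 2 : ℝ) : ℂ) • (1 : D) := by
      have : star x = z - ((t : ℂ) * Complex.I) • (1 : D) := by
        simp [hx, hzs.star_eq, sub_eq_add_neg]
      rw [this, hx, sub_mul, mul_add, mul_add, mul_smul_comm, smul_mul_assoc, smul_mul_smul_comm,
        mul_one, one_mul, one_mul, mul_mul_mul_comm, Complex.I_mul_I]
      have e : (t : ℂ) * t * (-1) = -((t ^ 2 : ℝ) : ℂ) := by push_cast; ring
      rw [e]
      module
    have hxn : ‖x‖ ^ 2 ≤ (R / 2) ^ 2 + t ^ 2 := by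
      rw [sq, ← CStarRing.norm_star_mul_self, hxx]
      refine (norm_add_le _ _).trans (add_le_add ?_ ?_)
      · refine (norm_mul_le _ _).trans ?_
        rw [sq]
        gcongr
      · rw [norm_smul, norm_one, mul_one, Complex.norm_real, Real.norm_of_nonneg (sq_nonneg t)]
    have hFx : F x = ⟨(F d).re - r * (R / 2), (F d).im + r * t⟩ := by
      rw [hx, hz, map_add, map_sub, map_smul, map_smul, h1]
      apply Complex.ext <;> simp <;> ring
    have h2 : ‖F x‖ ^ 2 ≤ r ^ 2 * ((R / 2) ^ 2 + t ^ 2) := by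
      calc ‖F x‖ ^ 2 ≤ (r * ‖x‖) ^ 2 := by gcongr; exact hF x
        _ = r ^ 2 * ‖x‖ ^ 2 := by ring
        _ ≤ _ := by gcongr
    rw [hFx, Complex.sq_norm, Complex.normSq_mk] at h2
    nlinarith [h2]
  have h0 := key 0
  have hF0 : ‖F d‖ ≤ r * R := hF d
  rcases hr.eq_or_lt with hr0 | hr0
  · rw [← hr0, zero_mul] at hF0
    rw [norm_le_zero_iff.1 hF0]
  have him : (F d).im = 0 := by
    by_contra hne
    -- the inequality is linear in `t`, with slope `2 * r * im (F d)`
    have := key ((r ^ 2 * (R / 2) ^ 2 + 1) / (2 * r * (F d).im))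
    have e : r * ((r ^ 2 * (R / 2) ^ 2 + 1) / (2 * r * (F d).im)) * (2 * (F d).im) =
        r ^ 2 * (R / 2) ^ 2 + 1 := by
      field_simp
    nlinarith [sq_nonneg ((F d).re - r * (R / 2)), sq_nonneg (F d).im]
  have hre : 0 ≤ (F d).re := by
    have h3 : |(F d).re - r * (R / 2)| ≤ r * (R / 2) := by
      refine abs_le_of_sq_le_sq ?_ (by positivity)
      nlinarith [sq_nonneg (F d).im]
    linarith [(abs_le.1 h3).1]
  exact Complex.nonneg_iff.2 ⟨hre, him.symm⟩

/-- A functional on a C⋆-subalgebra whose norm is its limit along the approximate unit extends to a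
positive functional on the whole algebra: a Hahn–Banach extension of the same norm attains its
norm at `1`. -/
lemma exists_positive_extension {C : Type*} [NonUnitalCStarAlgebra C] [PartialOrder C]
    [StarOrderedRing C] (i : C →⋆ₙₐ[ℂ] D) (hi : Function.Injective i) (f : C →ₗ[ℂ] ℂ) {r : ℝ}
    (hr : 0 ≤ r) (hf : ∀ c, ‖f c‖ ≤ r * ‖c‖)
    (hfr : Tendsto f (CStarAlgebra.approximateUnit C) (𝓝 (r : ℂ))) :
    ∃ F : D →ₚ[ℂ] ℂ, ∀ c, F (i c) = f c := by
  let e : C ≃ₗ[ℂ] (i : C →ₗ[ℂ] D).range := LinearEquiv.ofInjective (i : C →ₗ[ℂ] D) hi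
  have he : ∀ c, ((e c : (i : C →ₗ[ℂ] D).range) : D) = i c := fun c => rfl
  let f' : StrongDual ℂ (i : C →ₗ[ℂ] D).range :=
    (f ∘ₗ e.symm.toLinearMap).mkContinuous r fun y => by
      obtain ⟨c, rfl⟩ := e.surjective y
      have : ‖e c‖ = ‖c‖ := NonUnitalStarAlgHom.norm_map i hi c
      simpa [this] using hf c
  obtain ⟨F, hFf, hFn⟩ := exists_extension_norm_eq _ f'
  have hFn' : ‖F‖ ≤ r := hFn.trans_le (LinearMap.mkContinuous_norm_le _ hr _)
  have hFi : ∀ c, F (i c) = f c := fun c => by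
    rw [← he, hFf]
    simp [f']
  have hFle : ∀ d, ‖F d‖ ≤ r * ‖d‖ := fun d => F.le_of_opNorm_le hFn' d
  have hF1 : F 1 = r := by
    rcases subsingleton_or_nontrivial D with hD | hD
    · have h0 : f = 0 := by
        ext c
        rw [← hFi, Subsingleton.elim (i c) 0]
        simp
      rw [Subsingleton.elim (1 : D) 0, map_zero]
      rw [h0] at hfr
      exact tendsto_nhds_unique tendsto_const_nhds hfr
    have hb : ‖(2 * r : ℂ) - F 1‖ ≤ r := by
      have ht : Tendsto (fun c => 2 * f c - F 1) (CStarAlgebra.approximateUnit C)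
          (𝓝 (2 * r - F 1)) := (hfr.const_mul 2).sub_const _
      refine le_of_tendsto ht.norm ?_
      have hu := CStarAlgebra.increasingApproximateUnit C
      filter_upwards [hu.eventually_nonneg, hu.eventually_norm] with c hc hc1
      have h2 := norm_sub_half_smul_one_le (map_nonneg i hc)
        ((NonUnitalStarAlgHom.norm_apply_le i c).trans hc1)
      have h3 : 2 * f c - F 1 = 2 * F (i c - ((1 / 2 : ℝ) : ℂ) • (1 : D)) := by
        rw [map_sub, map_smul, hFi, smul_eq_mul]
        push_cast
        ring
      rw [h3, norm_mul, Complex.norm_ofNat]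
      nlinarith [hFle (i c - ((1 / 2 : ℝ) : ℂ) • (1 : D))]
    have hb' : ‖F 1‖ ≤ r := by simpa using hFle 1
    -- `F 1` and `2 * r - F 1` both lie in the disc of radius `r`, which forces `F 1 = r`
    have h4 : r ≤ (F 1).re := by
      have := (Complex.re_le_norm _).trans hb
      simp at this
      linarith
    have h5 : (F 1).re ^ 2 + (F 1).im ^ 2 ≤ r ^ 2 := by
      have : ‖F 1‖ ^ 2 ≤ r ^ 2 := by gcongr
      rw [Complex.sq_norm, Complex.normSq_apply] at this
      nlinarith
    have h6 : (F 1).re = r := le_antisymm ((Complex.re_le_norm _).trans hb') h4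
    have h7 : (F 1).im = 0 := by rw [h6] at h5; nlinarith [sq_nonneg (F 1).im]
    exact Complex.ext (by simpa using h6) (by simpa using h7)
  exact ⟨.mk₀ (F : D →ₗ[ℂ] ℂ) fun d hd => map_nonneg_of_norm_le_map_one _ hFle hF1 hd, hFi⟩

end StateExtension

/-! ### Extension of representations to completely positive maps -/

section Extension

open scoped ComplexOrder InnerProductSpace
open Filter Topology ContinuousLinearMap

variable {C : Type*} [NonUnitalCStarAlgebra C]
  {D : Type*} [CStarAlgebra D] [PartialOrder D] [StarOrderedRing D]
  {K : Type*} [NormedAddCommGroup K] [InnerProductSpace ℂ K] [CompleteSpace K]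

lemma inner_map_left (θ : C →⋆ₙₐ[ℂ] (K →L[ℂ] K)) (a : C) (ξ η : K) :
    ⟪θ a ξ, η⟫_ℂ = ⟪ξ, θ (star a) η⟫_ℂ := by
  rw [map_star, star_eq_adjoint, adjoint_inner_right]

variable [PartialOrder C] [StarOrderedRing C]

/-- A vector is essential for a representation if the approximate unit of the algebra fixes it in
the limit. As representations may be degenerate, not every vector is. -/
def IsEssentialVector (θ : C →⋆ₙₐ[ℂ] (K →L[ℂ] K)) (ξ : K) : Prop :=
  Tendsto (fun c => θ c ξ) (CStarAlgebra.approximateUnit C) (𝓝 ξ)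

lemma isEssentialVector_apply (θ : C →⋆ₙₐ[ℂ] (K →L[ℂ] K)) (c : C) (ξ : K) :
    IsEssentialVector θ (θ c ξ) := by
  have h1 : Continuous θ := map_continuous θ
  have h := (CStarAlgebra.increasingApproximateUnit C).tendsto_mul_right c
  have h2 : Continuous fun a => θ a ξ := by fun_prop
  refine ((h2.tendsto c).comp h).congr fun e => ?_
  simp

/-- The vector functional of an essential vector extends to a positive functional on a larger unital
C⋆-algebra. -/
lemma exists_positive_extension_vectorFunctional (i : C →⋆ₙₐ[ℂ] D) (hi : Function.Injective i)
    (θ : C →⋆ₙₐ[ℂ] (K →L[ℂ] K)) {ξ : K} (hξ : IsEssentialVector θ ξ) :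
    ∃ F : D →ₚ[ℂ] ℂ, ∀ c, F (i c) = ⟪ξ, θ c ξ⟫_ℂ := by
  let f : C →ₗ[ℂ] ℂ :=
    { toFun := fun c => ⟪ξ, θ c ξ⟫_ℂ
      map_add' := by simp
      map_smul' := by simp }
  refine exists_positive_extension i hi f (r := ‖ξ‖ ^ 2) (by positivity) (fun c => ?_) ?_
  · calc ‖⟪ξ, θ c ξ⟫_ℂ‖ ≤ ‖ξ‖ * (‖c‖ * ‖ξ‖) :=
          (norm_inner_le_norm _ _).trans (by
            gcongr
            exact (θ c).le_of_opNorm_le (NonUnitalStarAlgHom.norm_apply_le θ c) ξ)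
      _ = _ := by ring
  · have : ((‖ξ‖ ^ 2 : ℝ) : ℂ) = ⟪ξ, ξ⟫_ℂ := by
      rw [inner_self_eq_norm_sq_to_K]; norm_cast
    rw [this]
    exact tendsto_const_nhds.inner hξ

/-- Cyclic decomposition: there is a set of essential vectors that generate mutually orthogonal cyclic
subspaces, such that the representation vanishes on the orthogonal complement of all of them. -/
lemma exists_orthogonal_cyclic_vectors (θ : C →⋆ₙₐ[ℂ] (K →L[ℂ] K)) :
    ∃ S : Set K, (∀ ξ ∈ S, IsEssentialVector θ ξ) ∧
      (∀ ξ ∈ S, ∀ η ∈ S, ξ ≠ η → ∀ c, ⟪ξ, θ c η⟫_ℂ = 0) ∧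
      ∀ y, (∀ ξ ∈ S, ∀ c, ⟪θ c ξ, y⟫_ℂ = 0) → ∀ c, θ c y = 0 := by
  obtain ⟨S, hS⟩ := zorn_subset {S : Set K | (∀ ξ ∈ S, IsEssentialVector θ ξ) ∧
      ∀ ξ ∈ S, ∀ η ∈ S, ξ ≠ η → ∀ c, ⟪ξ, θ c η⟫_ℂ = 0} fun c hc hchain => by
    refine ⟨⋃₀ c, ⟨?_, ?_⟩, fun s hs => Set.subset_sUnion_of_mem hs⟩
    · rintro ξ ⟨s, hs, hξ⟩
      exact (hc hs).1 ξ hξ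
    · rintro ξ ⟨s, hs, hξ⟩ η ⟨t, ht, hη⟩
      rcases hchain.total hs ht with h | h
      · exact (hc ht).2 ξ (h hξ) η hη
      · exact (hc hs).2 ξ hξ η (h hη)
  refine ⟨S, hS.prop.1, hS.prop.2, fun y hy c => ?_⟩
  -- `θ c y` may be added to `S`, hence belongs to it
  have hz : ∀ ξ ∈ S, ∀ a, ⟪ξ, θ a (θ c y)⟫_ℂ = 0 := fun ξ hξ a => by
    have := hy ξ hξ (star (a * c))
    rwa [inner_map_left, star_star, map_mul] at this
  have hmem : θ c y ∈ S := by
    refine hS.le_of_ge (y := insert (θ c y) S) ⟨?_, ?_⟩ (Set.subset_insert _ _)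
      (Set.mem_insert _ _)
    · rintro ξ (rfl | hξ)
      · exact isEssentialVector_apply θ c y
      · exact hS.prop.1 ξ hξ
    · rintro ξ (rfl | hξ) η (rfl | hη) hne a
      · exact absurd rfl hne
      · rw [← star_star a, ← inner_map_left, ← inner_conj_symm, hz η hη, map_zero]
      · exact hz ξ hξ a
      · exact hS.prop.2 ξ hξ η hη hne a
  have := hy _ hmem (star c)
  rwa [inner_map_left, star_star, inner_self_eq_zero] at this

open Classical in
/-- Arveson's extension theorem for representations: a representation `θ` of a C⋆-subalgebra extends
to a contractive completely positive map on the whole unital C⋆-algebra. -/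
theorem exists_completelyPositive_extension (i : C →⋆ₙₐ[ℂ] D) (hi : Function.Injective i)
    (θ : C →⋆ₙₐ[ℂ] (K →L[ℂ] K)) :
    ∃ Θ : D →CP (K →L[ℂ] K), (∀ d, ‖Θ d‖ ≤ ‖d‖) ∧ ∀ c, Θ (i c) = θ c := by
  obtain ⟨S, hS1, hS2, hS3⟩ := exists_orthogonal_cyclic_vectors θ
  choose F hF using fun ξ : S => exists_positive_extension_vectorFunctional i hi θ (hS1 ξ ξ.2)
  let π : D →⋆ₙₐ[ℂ] (lp (fun ξ : S => (F ξ).GNS) 2 →L[ℂ] lp (fun ξ : S => (F ξ).GNS) 2) :=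
    directSumRep fun ξ => (F ξ).gnsNonUnitalStarAlgHom
  -- The finitely supported families `S →₀ C` map onto a dense subspace of the essential part of `K`
  -- by `T`, and into the sum of the GNS spaces by `T'`, with the same inner products.
  let T : (S →₀ C) →ₗ[ℂ] K := Finsupp.lsum ℂ fun ξ : S =>
    { toFun := fun c => θ c ξ
      map_add' := by simp
      map_smul' := by simp }
  let g : ∀ ξ : S, C →ₗ[ℂ] (F ξ).GNS := fun ξ =>
    { toFun := fun c => (((F ξ).toPreGNS (i c) : (F ξ).PreGNS) : (F ξ).GNS)
      map_add' := by simp [UniformSpace.Completion.coe_add]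
      map_smul' := by simp [UniformSpace.Completion.coe_smul] }
  let T' : (S →₀ C) →ₗ[ℂ] lp (fun ξ : S => (F ξ).GNS) 2 := Finsupp.lsum ℂ fun ξ : S =>
    { toFun := fun c => lp.single 2 ξ (g ξ c)
      map_add' := by simp
      map_smul' := by simp }
  have hT : ∀ ξ c, T (Finsupp.single ξ c) = θ c ξ := by simp [T]
  have hT' : ∀ ξ c, T' (Finsupp.single ξ c) = lp.single 2 ξ (g ξ c) := by simp [T']
  have hTT' : ∀ x y, ⟪T x, T y⟫_ℂ = ⟪T' x, T' y⟫_ℂ := fun x y => by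
    induction x using Finsupp.induction_linear with
    | zero => simp
    | add x₁ x₂ h₁ h₂ => simp only [map_add, inner_add_left, h₁, h₂]
    | single ξ a =>
      induction y using Finsupp.induction_linear with
      | zero => simp
      | add y₁ y₂ h₁ h₂ => simp only [map_add, inner_add_right, h₁, h₂]
      | single η b =>
        rw [hT, hT, hT', hT', lp.inner_single_left, lp.single_apply]
        rcases eq_or_ne ξ η with rfl | hne
        · rw [Pi.single_eq_same]
          change _ = inner ℂ (((F ξ).toPreGNS (i a) : (F ξ).PreGNS) : (F ξ).GNS)
            (((F ξ).toPreGNS (i b) : (F ξ).PreGNS) : (F ξ).GNS)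
          rw [UniformSpace.Completion.inner_coe, PositiveLinearMap.preGNS_inner_def,
            PositiveLinearMap.ofPreGNS_toPreGNS, PositiveLinearMap.ofPreGNS_toPreGNS, ← map_star,
            ← map_mul, hF, inner_map_left, map_mul]
          rfl
        · rw [Pi.single_eq_of_ne hne, inner_zero_right, inner_map_left,
            ← mul_apply_eq_comp, ← map_mul]
          exact hS2 ξ ξ.2 η η.2 (fun h => hne (Subtype.ext h)) _
  obtain ⟨V, hVn, hV1, hV2, hV3⟩ := exists_partialIsometry_of_inner_eq T T' hTT'
  have hΘ : ∀ d, ((compressionCP V).comp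
      (CompletelyPositiveMapClass.toCompletelyPositiveLinearMap π)) d =
        adjoint V ∘L π d ∘L V := fun d => rfl
  have hsingle : ∀ (c : C) (ξ : S) (a : C), π (i c) (T' (Finsupp.single ξ a)) =
      T' (Finsupp.single ξ (c * a)) := fun c ξ a => by
    rw [hT', hT', directSumRep_single]
    congr 1
    change (F ξ).gnsNonUnitalStarAlgHom (i c)
      (((F ξ).toPreGNS (i a) : (F ξ).PreGNS) : (F ξ).GNS) =
        (((F ξ).toPreGNS (i (c * a)) : (F ξ).PreGNS) : (F ξ).GNS)
    rw [PositiveLinearMap.gnsNonUnitalStarAlgHom_apply_coe,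
      PositiveLinearMap.leftMulMapPreGNS_apply, PositiveLinearMap.ofPreGNS_toPreGNS, map_mul i]
  refine ⟨(compressionCP V).comp (CompletelyPositiveMapClass.toCompletelyPositiveLinearMap π),
    fun d => ?_, fun c => ?_⟩
  · rw [hΘ]
    have hVn' : ‖adjoint V‖ ≤ 1 := by rwa [LinearIsometryEquiv.norm_map]
    calc ‖adjoint V ∘L π d ∘L V‖ ≤ ‖adjoint V‖ * (‖π d‖ * ‖V‖) :=
          (opNorm_comp_le _ _).trans (by gcongr; exact opNorm_comp_le _ _)
      _ ≤ 1 * (‖d‖ * 1) := by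
          gcongr
          exact NonUnitalStarAlgHom.norm_apply_le π d
      _ = ‖d‖ := by ring
  · refine eq_of_eq_on_range_of_eq_on_orthogonal T (fun x => ?_) fun y hy => ?_
    · rw [hΘ]
      change adjoint V (π (i c) (V (T x))) = θ c (T x)
      rw [hV1]
      induction x using Finsupp.induction_linear with
      | zero => simp
      | add x₁ x₂ h₁ h₂ => simp only [map_add, h₁, h₂]
      | single ξ a => rw [hsingle, hV2, hT, hT, map_mul]; rfl
    · rw [hΘ]
      change adjoint V (π (i c) (V y)) = θ c y
      rw [hV3 y hy, map_zero, map_zero]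
      exact (hS3 y (fun ξ hξ a => by rw [← hT ⟨ξ, hξ⟩]; exact hy _) c).symm

end Extension

/-! ### The rank of a power of a finite dimensional C⋆-algebra -/

section Rank

variable {B : Type*} [CStarAlgebra B]

lemma exists_maximal_commutative_starSubalgebra [FiniteDimensional ℂ B] :
    ∃ D : StarSubalgebra ℂ B,
      Maximal (fun S : StarSubalgebra ℂ B => ∀ x ∈ S, ∀ y ∈ S, x * y = y * x) D := by
  have hmono : StrictMono fun S : StarSubalgebra ℂ B => Subalgebra.toSubmodule S.toSubalgebra :=
    fun S T h => h
  have : WellFoundedGT (StarSubalgebra ℂ B) := hmono.wellFoundedGT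
  refine exists_maximal_of_wellFoundedGT _ ⟨⊥, ?_⟩
  rintro x hx y hy
  obtain ⟨a, rfl⟩ := StarSubalgebra.mem_bot.1 hx
  exact Algebra.commutes a y

/-- The star subalgebra of the power `ι → B` of the functions with values in `D`. -/
def StarSubalgebra.power (ι : Type*) (D : StarSubalgebra ℂ B) : StarSubalgebra ℂ (ι → B) where
  carrier := {x | ∀ i, x i ∈ D}
  mul_mem' hx hy i := mul_mem (hx i) (hy i)
  add_mem' hx hy i := add_mem (hx i) (hy i)
  algebraMap_mem' c _ := D.algebraMap_mem c
  star_mem' hx i := star_mem (hx i)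

lemma StarSubalgebra.maximal_power {ι : Type*} {D : StarSubalgebra ℂ B}
    (hD : Maximal (fun S : StarSubalgebra ℂ B => ∀ x ∈ S, ∀ y ∈ S, x * y = y * x) D) :
    Maximal (fun S : StarSubalgebra ℂ (ι → B) => ∀ x ∈ S, ∀ y ∈ S, x * y = y * x)
      (D.power ι) := by
  refine ⟨fun x hx y hy => funext fun i => hD.prop _ (hx i) _ (hy i), fun S hS hDS x hx i => ?_⟩
  refine hD.le_of_ge (y := S.map (Pi.evalStarAlgHom ℂ (fun _ : ι => B) i)) ?_ ?_ ⟨x, hx, rfl⟩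
  · rintro _ ⟨y, hy, rfl⟩ _ ⟨z, hz, rfl⟩
    exact congrFun (hS y hy z hz) i
  · exact fun d hd => ⟨fun _ => d, hDS fun _ => hd, rfl⟩

lemma StarSubalgebra.finrank_power {ι : Type*} [Fintype ι] [FiniteDimensional ℂ B]
    (D : StarSubalgebra ℂ B) :
    Module.finrank ℂ (D.power ι) = Fintype.card ι * Module.finrank ℂ D := by
  let e : D.power ι ≃ₗ[ℂ] (ι → D) :=
    { toFun := fun x i => ⟨x.1 i, x.2 i⟩
      invFun := fun x => ⟨fun i => (x i).1, fun i => (x i).2⟩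
      map_add' := fun _ _ => rfl
      map_smul' := fun _ _ => rfl }
  have : FiniteDimensional ℂ D :=
    inferInstanceAs (FiniteDimensional ℂ (Subalgebra.toSubmodule D.toSubalgebra))
  rw [e.finrank_eq, Module.finrank_pi_fintype]
  simp

lemma finDimRank_power_le (ι : Type*) [Fintype ι] [FiniteDimensional ℂ B] :
    finDimRank (ι → B) ≤ Fintype.card ι * finDimRank B := by
  obtain ⟨D₀, hD₀⟩ := exists_maximal_commutative_starSubalgebra (B := B)
  obtain ⟨D, hD, hr⟩ := Nat.sInf_mem (s := {d | ∃ D : StarSubalgebra ℂ B,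
    Maximal (fun S : StarSubalgebra ℂ B => ∀ x ∈ S, ∀ y ∈ S, x * y = y * x) D ∧
      d = Module.finrank ℂ D}) ⟨_, D₀, hD₀, rfl⟩
  refine Nat.sInf_le ⟨D.power ι, D.maximal_power hD, ?_⟩
  rw [StarSubalgebra.finrank_power, ← hr]
  rfl

end Rank

/-! ### Maps into and out of the mapping torus -/

section MappingTorusMaps

variable {A : Type*} [NonUnitalCStarAlgebra A] (α : A ≃⋆ₐ[ℂ] A)

/-- Evaluation at a point of `[0,1]`, as a homomorphism from the mapping torus. -/
def mappingTorusEval (s : I) : MappingTorus α →⋆ₙₐ[ℂ] A where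
  toFun f := f.1 s
  map_zero' := rfl
  map_add' _ _ := rfl
  map_mul' _ _ := rfl
  map_star' _ := rfl
  map_smul' _ _ := rfl

lemma mappingTorusEval_flow_one (f : MappingTorus α) (s : I) :
    mappingTorusEval α s (mappingTorusFlow α 1 f) = α (mappingTorusEval α s f) := by
  have hs : (s : ℝ) + 1 - ((1 : ℤ) : ℝ) ∈ I := by simp
  change mappingTorusExtend α f.1 (s + 1) = α (f.1 s)
  rw [mappingTorusExtend_of_mem α f.2 1 hs, zpow_one]
  congr 2
  ext
  simp

lemma mappingTorusEval_flow_one_iterate (f : MappingTorus α) (s : I) (j : ℕ) :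
    mappingTorusEval α s ((mappingTorusFlow α 1)^[j] f) = α^[j] (mappingTorusEval α s f) := by
  induction j with
  | zero => rfl
  | succ j ih =>
    rw [Function.iterate_succ_apply', Function.iterate_succ_apply', mappingTorusEval_flow_one, ih]

lemma mappingTorus_ext {f g : MappingTorus α}
    (h : ∀ s, mappingTorusEval α s f = mappingTorusEval α s g) : f = g :=
  Subtype.ext (ContinuousMap.ext h)

lemma mappingTorus_norm_le {f : MappingTorus α} {r : ℝ} (hr : 0 ≤ r)
    (h : ∀ s, ‖mappingTorusEval α s f‖ ≤ r) : ‖f‖ ≤ r :=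
  (ContinuousMap.norm_le f.1 hr).2 h

/-- The sections in a finite subset of the mapping torus are uniformly close to step functions that
take only their values at the finitely many sample points in `t`; `q s` is the sample point assigned
to `s`. -/
lemma exists_finite_sampling (ω : Finset (MappingTorus α)) {ε : ℝ} (hε : 0 < ε) :
    ∃ (t : Finset I) (q : I → t), ∀ f ∈ ω, ∀ s,
      ‖mappingTorusEval α (q s : I) f - mappingTorusEval α s f‖ ≤ ε := by
  let F : I → (ω → A) := fun s f => mappingTorusEval α s f
  have hF : Continuous F := continuous_pi fun f => f.1.1.continuous
  obtain ⟨η, hη, h⟩ := Metric.uniformContinuous_iff.1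
    (CompactSpace.uniformContinuous_of_continuous hF) ε hε
  obtain ⟨t, -, htf, ht⟩ := finite_cover_balls_of_compact (isCompact_univ (X := I)) hη
  have hq : ∀ s : I, ∃ p : htf.toFinset, dist (p : I) s < η := fun s => by
    obtain ⟨p, hp, hs⟩ := Set.mem_iUnion₂.1 (ht (Set.mem_univ s))
    exact ⟨⟨p, htf.mem_toFinset.2 hp⟩, (dist_comm _ _).trans_lt hs⟩
  choose q hq using hq
  refine ⟨htf.toFinset, q, fun f hf s => ?_⟩
  rw [← dist_eq_norm]
  exact (dist_le_pi_dist (F (q s)) (F s) ⟨f, hf⟩).trans (h (hq s)).le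

section Representation

variable {H : Type*} [NormedAddCommGroup H] [InnerProductSpace ℂ H] [CompleteSpace H]

/-- The representation of the mapping torus on `ℓ²([0,1], H)` by the diagonal operators with entries
`π (f s)`. -/
def mappingTorusRep (π : A →⋆ₙₐ[ℂ] (H →L[ℂ] H)) :
    MappingTorus α →⋆ₙₐ[ℂ] (lp (fun _ : I => H) 2 →L[ℂ] lp (fun _ : I => H) 2) :=
  directSumRep fun s => π.comp (mappingTorusEval α s)

lemma mappingTorusRep_injective {π : A →⋆ₙₐ[ℂ] (H →L[ℂ] H)}
    (hπ : Function.Injective π) : Function.Injective (mappingTorusRep α π) :=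
  directSumRep_injective _ fun f hf => mappingTorus_ext α fun s =>
    hπ ((hf s).trans (by simp))

end Representation

/-- The element `s ↦ h s • a` of the mapping torus, where `h` vanishes at both ends of `[0,1]`, as a
linear function of `a`. -/
def mappingTorusBump (h : C(I, ℝ)) (h0 : h 0 = 0) (h1 : h 1 = 0) : A →ₗ[ℂ] MappingTorus α where
  toFun a := ⟨⟨fun s => (h s : ℂ) • a, by fun_prop⟩, by
    rw [mem_mappingTorusSubalgebra]; simp [h0, h1]⟩
  map_add' a b := mappingTorus_ext α fun s => smul_add (h s : ℂ) a b
  map_smul' c a := mappingTorus_ext α fun s => smul_comm (h s : ℂ) c a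

lemma mappingTorusEval_bump (h : C(I, ℝ)) (h0 : h 0 = 0) (h1 : h 1 = 0) (a : A) (s : I) :
    mappingTorusEval α s (mappingTorusBump α h h0 h1 a) = (h s : ℂ) • a := rfl

variable [PartialOrder A] [StarOrderedRing A]

/-- The map `a ↦ (s ↦ h s ^ 2 • a)`, as a completely positive map into the mapping torus. The square
makes positivity of matrices evident. -/
def mappingTorusBumpCP (h : C(I, ℝ)) (h0 : h 0 = 0) (h1 : h 1 = 0) : A →CP MappingTorus α :=
  .ofStarMulSelf (mappingTorusBump α (h * h) (by simp [h0]) (by simp [h1])) fun k N => by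
    refine ⟨N.map (mappingTorusBump α h h0 h1), CStarMatrix.ext fun a b => ?_⟩
    rw [CStarMatrix.map_apply, CStarMatrix.star_mul_self_apply, CStarMatrix.star_mul_self_apply]
    refine mappingTorus_ext α fun s => ?_
    rw [map_sum (mappingTorusEval α s), mappingTorusEval_bump, Finset.smul_sum]
    refine Finset.sum_congr rfl fun l _ => ?_
    rw [CStarMatrix.map_apply, CStarMatrix.map_apply, map_mul, map_star, mappingTorusEval_bump,
      mappingTorusEval_bump, star_smul, smul_mul_smul_comm]
    simp

lemma mappingTorusEval_bumpCP (h : C(I, ℝ)) (h0 : h 0 = 0) (h1 : h 1 = 0) (a : A) (s : I) :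
    mappingTorusEval α s (mappingTorusBumpCP α h h0 h1 a) = ((h s * h s : ℝ) : ℂ) • a := rfl

lemma mappingTorusFlow_one_iterate_bumpCP (h : C(I, ℝ)) (h0 : h 0 = 0) (h1 : h 1 = 0) (a : A)
    (j : ℕ) : (mappingTorusFlow α 1)^[j] (mappingTorusBumpCP α h h0 h1 a) =
      mappingTorusBumpCP α h h0 h1 (α^[j] a) := by
  refine mappingTorus_ext α fun s => ?_
  rw [mappingTorusEval_flow_one_iterate, mappingTorusEval_bumpCP, mappingTorusEval_bumpCP]
  induction j with
  | zero => rfl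
  | succ j ih => rw [Function.iterate_succ_apply', Function.iterate_succ_apply', ih, map_smul]

end MappingTorusMaps

/-! ### Operations on completely positive approximations -/

section Entropy

variable {A A' : Type*} [NonUnitalCStarAlgebra A] [PartialOrder A] [StarOrderedRing A]
  [NonUnitalCStarAlgebra A'] [PartialOrder A'] [StarOrderedRing A']
  {H K : Type*} [NormedAddCommGroup H] [InnerProductSpace ℂ H] [CompleteSpace H]
  [NormedAddCommGroup K] [InnerProductSpace ℂ K] [CompleteSpace K]

attribute [local instance] CPApprox.cstarAlgebra CPApprox.partialOrder CPApprox.starOrderedRing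
  CPApprox.finiteDimensional

/-- Precomposition and postcomposition of an approximation with contractive completely positive
maps. -/
def CPApprox.mapBoth (P : CPApprox A H) (F : A' →CP A) (hF : ∀ a, ‖F a‖ ≤ ‖a‖)
    (Θ : (H →L[ℂ] H) →CP (K →L[ℂ] K)) (hΘ : ∀ T, ‖Θ T‖ ≤ ‖T‖) : CPApprox A' K where
  B := P.B
  φ := P.φ.comp F
  ψ := Θ.comp P.ψ
  norm_φ_le a := (P.norm_φ_le _).trans (hF a)
  norm_ψ_le b := (hΘ _).trans (P.norm_ψ_le b)

@[simp] lemma CPApprox.mapBoth_rank (P : CPApprox A H) (F : A' →CP A) (hF)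
    (Θ : (H →L[ℂ] H) →CP (K →L[ℂ] K)) (hΘ) : (P.mapBoth F hF Θ hΘ).rank = P.rank := rfl

@[simp] lemma CPApprox.mapBoth_comp (P : CPApprox A H) (F : A' →CP A) (hF)
    (Θ : (H →L[ℂ] H) →CP (K →L[ℂ] K)) (hΘ) (a : A') :
    (P.mapBoth F hF Θ hΘ).comp a = Θ (P.comp (F a)) := rfl

lemma norm_apply_sub_le {E E' : Type*} [SeminormedAddCommGroup E] [SeminormedAddCommGroup E']
    {𝓕 : Type*} [FunLike 𝓕 E E'] [AddMonoidHomClass 𝓕 E E'] (Θ : 𝓕) (hΘ : ∀ T, ‖Θ T‖ ≤ ‖T‖)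
    (S T : E) : ‖Θ S - Θ T‖ ≤ ‖S - T‖ := by
  rw [← map_sub]
  exact hΘ _

/-- The representation of `B(H) ^ t` on `ℓ²([0,1], H)` in which `T` acts as the diagonal operator with
entries `T (q s)`. -/
def samplingRep (H : Type*) [NormedAddCommGroup H] [InnerProductSpace ℂ H] [CompleteSpace H]
    {t : Finset I} (q : I → t) :
    (t → H →L[ℂ] H) →⋆ₙₐ[ℂ] (lp (fun _ : I => H) 2 →L[ℂ] lp (fun _ : I => H) 2) :=
  directSumRep fun s : I =>
    ((Pi.evalStarAlgHom ℂ (fun _ : t => H →L[ℂ] H) (q s) :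
      (t → H →L[ℂ] H) →⋆ₐ[ℂ] (H →L[ℂ] H)) : (t → H →L[ℂ] H) →⋆ₙₐ[ℂ] (H →L[ℂ] H))

/-- The approximation `(φ', ψ', B ^ t)` of the mapping torus on `ℓ²([0,1], H)` obtained from an
approximation `(φ, ψ, B)` of `A` on `H` by sampling at the points of `t`:
`φ' f = (φ (f s))_{s ∈ t}`, and `ψ' b` is the diagonal operator with entries `ψ (b (q s))`. -/
def CPApprox.mappingTorus (P : CPApprox A H) (α : A ≃⋆ₐ[ℂ] A) {t : Finset I} (q : I → t) :
    CPApprox (MappingTorus α) (lp (fun _ : I => H) 2) where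
  B := t → P.B
  φ := .pi fun s => P.φ.comp
    (CompletelyPositiveMapClass.toCompletelyPositiveLinearMap (mappingTorusEval α (s : I)))
  ψ := (CompletelyPositiveMapClass.toCompletelyPositiveLinearMap (samplingRep H q)).comp
    (.pi fun s => P.ψ.comp (CompletelyPositiveMapClass.toCompletelyPositiveLinearMap
      (Pi.evalStarAlgHom ℂ (fun _ : t => P.B) s)))
  norm_φ_le f := (pi_norm_le_iff_of_nonneg (norm_nonneg f)).2 fun s =>
    (P.norm_φ_le _).trans (NonUnitalStarAlgHom.norm_apply_le (mappingTorusEval α (s : I)) f)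
  norm_ψ_le b := (NonUnitalStarAlgHom.norm_apply_le (samplingRep H q) _).trans <|
    (pi_norm_le_iff_of_nonneg (norm_nonneg b)).2 fun s =>
      (P.norm_ψ_le _).trans (norm_le_pi_norm b s)

lemma CPApprox.mappingTorus_rank_le (P : CPApprox A H) (α : A ≃⋆ₐ[ℂ] A) {t : Finset I}
    (q : I → t) : (P.mappingTorus α q).rank ≤ t.card * P.rank := by
  have := finDimRank_power_le (B := P.B) t
  rwa [Fintype.card_coe] at this

lemma CPApprox.norm_mappingTorus_comp_sub_le (α : A ≃⋆ₐ[ℂ] A) (π : A →⋆ₙₐ[ℂ] (H →L[ℂ] H))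
    (P : CPApprox A H) {t : Finset I} (q : I → t) (f : MappingTorus α) {ε r : ℝ}
    (hf : ∀ s, ‖mappingTorusEval α (q s : I) f - mappingTorusEval α s f‖ ≤ ε)
    (hP : ∀ s ∈ t, ‖P.comp (mappingTorusEval α s f) - π (mappingTorusEval α s f)‖ ≤ r) :
    ‖(P.mappingTorus α q).comp f - mappingTorusRep α π f‖ ≤ r + ε := by
  have hb : ∀ s, ‖P.comp (mappingTorusEval α (q s : I) f) - π (mappingTorusEval α s f)‖ ≤
      r + ε := fun s => by
    refine (norm_sub_le_norm_sub_add_norm_sub _ (π (mappingTorusEval α (q s : I) f)) _).trans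
      (add_le_add (hP _ (q s).2) ?_)
    exact (norm_apply_sub_le π (NonUnitalStarAlgHom.norm_apply_le π) _ _).trans (hf s)
  exact norm_le_of_diagonal
    (fun s => P.comp (mappingTorusEval α (q s : I) f) - π (mappingTorusEval α s f))
    (fun x s => rfl) ((norm_nonneg _).trans (hb 0)) hb

/-! ### Comparison of entropies -/

lemma rcp_le_mul {ρ : A' →⋆ₙₐ[ℂ] (K →L[ℂ] K)} {π : A →⋆ₙₐ[ℂ] (H →L[ℂ] H)} {ω' : Set A'}
    {ω : Set A} {δ' δ : ℝ} {n : ℕ} (hn : n ≠ 0)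
    (h : ∀ P : CPApprox A H, P.Approximates π ω δ →
      ∃ Q : CPApprox A' K, Q.Approximates ρ ω' δ' ∧ Q.rank ≤ n * P.rank) :
    rcp ρ ω' δ' ≤ n * rcp π ω δ := by
  rw [rcp, rcp, ENat.mul_iInf_of_ne (by exact_mod_cast hn)]
  refine le_iInf fun P => ?_
  obtain ⟨Q, hQ, hr⟩ := h P.1 P.2
  refine (iInf_le _ ⟨Q, hQ⟩).trans ?_
  exact_mod_cast hr

lemma htAt_eq_expGrowthSup (π : A →⋆ₙₐ[ℂ] (H →L[ℂ] H)) (α : A ≃⋆ₐ[ℂ] A) (ω : Set A) (δ : ℝ) :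
    htAt π α ω δ = ExpGrowth.expGrowthSup fun m : ℕ =>
      ((rcp π (⋃ j : Fin m, (⇑α)^[(j : ℕ)] '' ω) δ : ℕ∞) : ENNReal) := by
  rw [htAt, ExpGrowth.expGrowthSup_def]
  congr 1
  funext m
  rw [EReal.div_eq_inv_mul, one_div, EReal.coe_inv, EReal.coe_natCast, Function.comp_apply]

lemma htAt_le_of_rcp_le_mul {ρ : A' →⋆ₙₐ[ℂ] (K →L[ℂ] K)} {π : A →⋆ₙₐ[ℂ] (H →L[ℂ] H)}
    {β : A' ≃⋆ₐ[ℂ] A'} {α : A ≃⋆ₐ[ℂ] A} {ω' : Set A'} {ω : Set A} {δ' δ : ℝ} (n : ℕ)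
    (h : ∀ m : ℕ, rcp ρ (⋃ j : Fin m, (⇑β)^[(j : ℕ)] '' ω') δ' ≤
      n * rcp π (⋃ j : Fin m, (⇑α)^[(j : ℕ)] '' ω) δ) :
    htAt ρ β ω' δ' ≤ htAt π α ω δ := by
  rw [htAt_eq_expGrowthSup, htAt_eq_expGrowthSup]
  refine ExpGrowth.expGrowthSup_le_of_eventually_le (ENNReal.natCast_ne_top n)
    (.of_forall fun m => ?_)
  have := ENat.toENNReal_mono (h m)
  simpa using this

end Entropy

section Comparison

variable {A A' : Type*} [NonUnitalCStarAlgebra A] [PartialOrder A] [StarOrderedRing A]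
  [NonUnitalCStarAlgebra A'] [PartialOrder A'] [StarOrderedRing A']
  {H K : Type*} [NormedAddCommGroup H] [InnerProductSpace ℂ H] [CompleteSpace H]
  [NormedAddCommGroup K] [InnerProductSpace ℂ K] [CompleteSpace K]

/-- Approximations of `F '' ω` in a faithful representation `ρ` of `A` give approximations of `ω` of
the same rank in `π`, if `π = θ ∘ F` for some representation `θ` of `A`: extend `θ ∘ ρ⁻¹` to the
bounded operators and compose. -/
lemma rcp_le_rcp_image {ρ : A →⋆ₙₐ[ℂ] (K →L[ℂ] K)} (hρ : Function.Injective ρ)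
    (θ : A →⋆ₙₐ[ℂ] (H →L[ℂ] H)) {π : A' →⋆ₙₐ[ℂ] (H →L[ℂ] H)} (F : A' →CP A)
    (hF : ∀ a, ‖F a‖ ≤ ‖a‖) (hθ : ∀ a, θ (F a) = π a) (ω : Set A') (δ : ℝ) :
    rcp π ω δ ≤ rcp ρ (F '' ω) δ := by
  obtain ⟨Θ, hΘ, hΘρ⟩ := exists_completelyPositive_extension ρ hρ θ
  have := rcp_le_mul (ρ := π) (π := ρ) (ω' := ω) (ω := F '' ω) (δ' := δ) (δ := δ) one_ne_zero
    fun P hP => by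
      refine ⟨P.mapBoth F hF Θ hΘ, fun a ha => ?_, by simp⟩
      rw [CPApprox.mapBoth_comp, ← hθ, ← hΘρ]
      exact (norm_apply_sub_le Θ hΘ _ _).trans_lt (hP _ ⟨a, ha, rfl⟩)
  simpa using this

/-- In a faithful representation `rcp` has its largest value, which is therefore the same for all of
them. -/
lemma rcp_le_rcp_of_injective {π : A →⋆ₙₐ[ℂ] (H →L[ℂ] H)} (hπ : Function.Injective π)
    (ρ : A →⋆ₙₐ[ℂ] (K →L[ℂ] K)) (ω : Set A) (δ : ℝ) : rcp ρ ω δ ≤ rcp π ω δ := by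
  have := rcp_le_rcp_image hπ ρ (π := ρ)
    (CompletelyPositiveMapClass.toCompletelyPositiveLinearMap (NonUnitalStarAlgHom.id ℂ A))
    (fun a => le_rfl) (fun a => rfl) ω δ
  rwa [show (CompletelyPositiveMapClass.toCompletelyPositiveLinearMap
    (NonUnitalStarAlgHom.id ℂ A) : A → A) '' ω = ω from Set.image_id ω] at this

/-- The function `s ↦ 4 s (1 - s)` on `[0,1]`. -/
def bumpFunction : C(I, ℝ) := ⟨fun s => 4 * (s : ℝ) * (1 - s), by fun_prop⟩

lemma bumpFunction_apply (s : I) : bumpFunction s = 4 * (s : ℝ) * (1 - s) := rfl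

lemma bumpFunction_mem (s : I) : 0 ≤ bumpFunction s ∧ bumpFunction s ≤ 1 := by
  rw [bumpFunction_apply]
  have := s.2.1
  have := s.2.2
  constructor
  · have : 0 ≤ 1 - (s : ℝ) := by linarith
    positivity
  · nlinarith [sq_nonneg (2 * (s : ℝ) - 1)]

variable (α : A ≃⋆ₐ[ℂ] A)

lemma ht_le_ht_mappingTorusFlow (π : A →⋆ₙₐ[ℂ] (H →L[ℂ] H))
    {ρ : MappingTorus α →⋆ₙₐ[ℂ] (K →L[ℂ] K)} (hρ : Function.Injective ρ) :
    ht π α ≤ ht ρ (mappingTorusFlow α 1) := by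
  classical
  let h := bumpFunction
  have h0 : h 0 = 0 := by simp [h, bumpFunction_apply]
  have h1 : h 1 = 0 := by simp [h, bumpFunction_apply]
  let F := mappingTorusBumpCP α h h0 h1
  have hF : ∀ a, ‖F a‖ ≤ ‖a‖ := fun a => mappingTorus_norm_le α (norm_nonneg a) fun s => by
    rw [mappingTorusEval_bumpCP, norm_smul, Complex.norm_real, norm_mul]
    have := (bumpFunction_mem s).1
    rw [Real.norm_of_nonneg this]
    exact mul_le_of_le_one_left (norm_nonneg a)
      (mul_le_one₀ (bumpFunction_mem s).2 this (bumpFunction_mem s).2)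
  let p : I := ⟨1 / 2, by norm_num, by norm_num⟩
  have hp : h p = 1 := by simp only [h, bumpFunction_apply, p]; norm_num
  have hθ : ∀ a, π.comp (mappingTorusEval α p) (F a) = π a := fun a => by
    rw [NonUnitalStarAlgHom.comp_apply, mappingTorusEval_bumpCP, hp]
    simp
  have hit : ∀ a (j : ℕ), F (α^[j] a) = (mappingTorusFlow α 1)^[j] (F a) := fun a j =>
    (mappingTorusFlow_one_iterate_bumpCP α h h0 h1 a j).symm
  refine iSup_le fun ω => iSup_le fun δ =>
    le_iSup_of_le (ω.image F) (le_iSup_of_le δ (htAt_le_of_rcp_le_mul 1 fun m => ?_))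
  have := rcp_le_rcp_image hρ _ F hF hθ (⋃ j : Fin m, (⇑α)^[(j : ℕ)] '' (ω : Set A)) δ
  rw [Nat.cast_one, one_mul]
  convert this using 2
  rw [Set.image_iUnion, Finset.coe_image]
  refine Set.iUnion_congr fun j => ?_
  rw [Set.image_image, Set.image_image]
  exact Set.image_congr fun a _ => (hit a j).symm

lemma ht_mappingTorusFlow_le_ht {π : A →⋆ₙₐ[ℂ] (H →L[ℂ] H)} (hπ : Function.Injective π)
    (ρ : MappingTorus α →⋆ₙₐ[ℂ] (K →L[ℂ] K)) :
    ht ρ (mappingTorusFlow α 1) ≤ ht π α := by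
  classical
  refine iSup_le fun ω => iSup_le fun δ => ?_
  have hδ : (0 : ℝ) < δ / 2 := half_pos δ.2
  obtain ⟨t, q, hq⟩ := exists_finite_sampling α ω (ε := δ / 3) (by linarith)
  let ω₀ : Finset A := Finset.image₂ (fun s f => mappingTorusEval α s f) t ω
  refine le_iSup_of_le ω₀ (le_iSup_of_le ⟨δ / 2, hδ⟩ (htAt_le_of_rcp_le_mul t.card fun m => ?_))
  refine (rcp_le_rcp_of_injective (mappingTorusRep_injective α hπ) ρ _ _).trans
    (rcp_le_mul (Finset.card_ne_zero_of_mem (q 0).2) fun P hP =>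
      ⟨P.mappingTorus α q, ?_, P.mappingTorus_rank_le α q⟩)
  intro x hx
  obtain ⟨j, f, hf, rfl⟩ := Set.mem_iUnion.1 hx
  have hf' : ∀ s, mappingTorusEval α s ((mappingTorusFlow α 1)^[j] f) =
      α^[j] (mappingTorusEval α s f) := fun s => mappingTorusEval_flow_one_iterate α f s j
  -- the iterates of `α` are isometric, so that the samples serve the whole orbit of `f`
  have hiso : Isometry (α^[j]) := by
    induction (j : ℕ) with
    | zero => exact isometry_id
    | succ k ih => rw [Function.iterate_succ]; exact ih.comp (StarAlgEquiv.isometry α)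
  refine (P.norm_mappingTorus_comp_sub_le α π q _ (ε := δ / 3) (fun s => ?_) fun s hs =>
    (hP _ ?_).le).trans_lt (show (δ : ℝ) / 2 + δ / 3 < δ by linarith)
  · rw [hf', hf', ← dist_eq_norm, hiso.dist_eq, dist_eq_norm]
    exact hq f hf s
  · rw [hf']
    exact Set.mem_iUnion.2 ⟨j, _, Finset.mem_image₂_of_mem hs hf, rfl⟩

lemma IsExactCStarAlgebra.mappingTorus {A : Type u} [NonUnitalCStarAlgebra A] [PartialOrder A]
    [StarOrderedRing A] (hA : IsExactCStarAlgebra A) (α : A ≃⋆ₐ[ℂ] A) :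
    IsExactCStarAlgebra (MappingTorus α) := by
  classical
  obtain ⟨H, _, _, _, π, hπ, h⟩ := hA
  refine ⟨lp (fun _ : I => H) 2, inferInstance, inferInstance, inferInstance, mappingTorusRep α π,
    mappingTorusRep_injective α hπ, fun ω δ hδ => ?_⟩
  obtain ⟨t, q, hq⟩ := exists_finite_sampling α ω (ε := δ / 3) (by positivity)
  obtain ⟨P, hP⟩ := h (Finset.image₂ (fun s f => mappingTorusEval α s f) t ω) (δ / 3)
    (by positivity)
  refine ⟨P.mappingTorus α q, fun f hf => ?_⟩
  refine (P.norm_mappingTorus_comp_sub_le α π q f (hq f hf) fun s hs =>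
    (hP _ (Finset.mem_image₂_of_mem hs hf)).le).trans_lt ?_
  linarith

end Comparison

end

theorem proposition2p3 {A : Type u} [NonUnitalCStarAlgebra A] [PartialOrder A]
    [StarOrderedRing A] (hA : IsExactCStarAlgebra A) (α : A ≃⋆ₐ[ℂ] A) :
    IsExactCStarAlgebra (MappingTorus α) ∧
      ∀ (H : Type v) [NormedAddCommGroup H] [InnerProductSpace ℂ H] [CompleteSpace H]
        (K : Type w) [NormedAddCommGroup K] [InnerProductSpace ℂ K] [CompleteSpace K]
        (π : A →⋆ₙₐ[ℂ] (H →L[ℂ] H)) (ρ : MappingTorus α →⋆ₙₐ[ℂ] (K →L[ℂ] K)),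
        Function.Injective π → Function.Injective ρ →
          ht ρ (mappingTorusFlow α 1) = ht π α :=
  ⟨hA.mappingTorus α, fun _ _ _ _ _ _ _ _ π ρ hπ hρ =>
    le_antisymm (ht_mappingTorusFlow_le_ht α hπ ρ) (ht_le_ht_mappingTorusFlow α π hρ)⟩
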